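/- Let $(\mathcal{C},\mathbb{E},\mathfrak{s})$ be an extriangulated category in the sense of Nakaoka and Palu (no assumption on projectives or injectives). Let $\mathfrak{s}\text{-tri}(\mathcal{C})$ be the category whose objects are the $\mathfrak{s}$-triangles $X_\bullet=(X_1\xrightarrow{f_1}X_2\xrightarrow{f_2}X_3\overset{\delta}{\dashrightarrow})$ and whose morphisms $\varphi_\bullet$ from $X_\bullet$ to $Y_\bullet=(Y_1\xrightarrow{g_1}Y_2\xrightarrow{g_2}Y_3\overset{\delta'}{\dashrightarrow})$ are the triples $(\varphi_1,\varphi_2,\varphi_3)$ of morphisms $\varphi_j:X_j\to Y_j$ with $\varphi_2f_1=g_1\varphi_1$, $\varphi_3f_2=g_2\varphi_2$ and $(\varphi_1)_*\delta=(\varphi_3)^*\delta'$. Let $\mathcal{R}_2$ be the ideal of those $\varphi_\bullet$ for which $\varphi_3$ factors through $g_2$, and write $\underline{\varphi_\bullet}$ for the class of $\varphi_\bullet$ in the ideal quotient $\mathfrak{s}\text{-tri}(\mathcal{C})/\mathcal{R}_2$, with the additive structure induced by componentwise addition. Then $\mathfrak{s}\text{-tri}(\mathcal{C})/\mathcal{R}_2$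 is an abelian category. Moreover, kernels, cokernels and images are given explicitly as follows. Let $\varphi_\bullet:X_\bullet\to Y_\bullet$ be a morphism of $\mathfrak{s}$-triangles as above. Then there is an $\mathfrak{s}$-triangle $I(\varphi_\bullet)=(Y_1\xrightarrow{h_1}Z\xrightarrow{h_2}X_3\overset{(\varphi_1)_*\delta}{\dashrightarrow})$, and for every such $\mathfrak{s}$-triangle there are morphisms $a_1:X_2\to Z$ and $a_2:Z\to Y_2$ with $$a_1f_1=h_1\varphi_1,\quad h_2a_1=f_2,\quad a_2h_1=g_1,\quad g_2a_2=\varphi_3h_2,$$ such that $$K(\varphi_\bullet)=\Big(X_1\xrightarrow{\binom{f_1}{\varphi_1}}X_2\oplus Y_1\xrightarrow{(a_1,\,-h_1)}Z\overset{h_2^*\delta}{\dashrightarrow}\Big),\qquad C(\varphi_\bullet)=\Big(Z\xrightarrow{\binom{h_2}{a_2}}X_3\oplus Y_2\xrightarrow{(-\varphi_3,\,g_2)}Y_3\overset{(h_1)_*\delta'}{\dashrightarrow}\Big)$$ are $\mathfrak{s}$-triangles. For any such choice of $h_1,h_2,a_1,a_2$, the triples $$k_\bullet=(1,(1,0),h_2):K(\varphi_\bullet)\to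 X_\bullet,\quad \pi_\bullet=(\varphi_1,a_1,1):X_\bullet\to I(\varphi_\bullet),\quad i_\bullet=(1,a_2,\varphi_3):I(\varphi_\bullet)\to Y_\bullet,\quad c_\bullet=(h_1,\tbinom{0}{1},1):Y_\bullet\to C(\varphi_\bullet)$$ are morphisms of $\mathfrak{s}$-triangles, and in $\mathfrak{s}\text{-tri}(\mathcal{C})/\mathcal{R}_2$ one has $\underline{\varphi_\bullet}=\underline{i_\bullet}\,\underline{\pi_\bullet}$, $\underline{k_\bullet}$ is a kernel of $\underline{\varphi_\bullet}$, $\underline{c_\bullet}$ is a cokernel of $\underline{\varphi_\bullet}$, $\underline{\pi_\bullet}$ is a cokernel of $\underline{k_\bullet}$, and $\underline{i_\bullet}$ is a kernel of $\underline{c_\bullet}$. -/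

import Mathlib

open CategoryTheory CategoryTheory.Limits Opposite

universe w v u

namespace Extriangulated

section Extensions

variable {C : Type u} [Category.{v} C] (E : Cᵒᵖ ⥤ C ⥤ AddCommGrpCat.{w})

/-- The group `𝔼(Z, A)` of `𝔼`-extensions of `Z` by `A`. -/
abbrev Ext (Z A : C) : Type w := ((E.obj (op Z)).obj A : AddCommGrpCat.{w})

variable {E}

/-- `a_* δ = 𝔼(Z, a)(δ)`. -/
def push {Z A A' : C} (a : A ⟶ A') (δ : Ext E Z A) : Ext E Z A' :=
  ((E.obj (op Z)).map a).hom δ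

/-- `c^* δ = 𝔼(c, A)(δ)`. -/
def pull {Z Z' A : C} (c : Z' ⟶ Z) (δ : Ext E Z A) : Ext E Z' A :=
  ((E.map c.op).app A).hom δ

/-- `(a, c) : δ ⟶ δ'` is a morphism of `𝔼`-extensions. -/
def IsExtHom {A Z A' Z' : C} (δ : Ext E Z A) (δ' : Ext E Z' A') (a : A ⟶ A') (c : Z ⟶ Z') :
    Prop :=
  push a δ = pull c δ'

/-- `δ ⊕ δ' ∈ 𝔼(Z ⊞ Z', A ⊞ A')`, the element with components `(δ, 0, 0, δ')`. -/
noncomputable def extSum [Preadditive C] [HasBinaryBiproducts C] {A Z A' Z' : C}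
    (δ : Ext E Z A) (δ' : Ext E Z' A') : Ext E (Z ⊞ Z') (A ⊞ A') :=
  push biprod.inl (pull biprod.fst δ) + push biprod.inr (pull biprod.snd δ')

end Extensions

section Sequences

variable {C : Type u} [Category.{v} C]

/-- A sequence `A ⟶ B ⟶ Z` with fixed ends `A` and `Z`. -/
structure Seq (A Z : C) where
  mid : C
  inf : A ⟶ mid
  defl : mid ⟶ Z

/-- Two sequences with the same ends are equivalent if some isomorphism of the middle terms is
compatible with the identities of the ends. -/
def Seq.Equivalent {A Z : C} (S T : Seq A Z) : Prop :=
  ∃ b : S.mid ≅ T.mid, S.inf ≫ b.hom = T.inf ∧ b.hom ≫ T.defl = S.defl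

instance Seq.setoid (A Z : C) : Setoid (Seq A Z) where
  r := Seq.Equivalent
  iseqv :=
    { refl := fun S => ⟨Iso.refl _, by simp, by simp⟩
      symm := by
        rintro S T ⟨b, h₁, h₂⟩
        exact ⟨b.symm, by simp [← h₁], by simp [← h₂]⟩
      trans := by
        rintro S T U ⟨b, h₁, h₂⟩ ⟨c, h₃, h₄⟩
        exact ⟨b ≪≫ c, by simp [← h₃, ← h₁], by simp [← h₂, ← h₄]⟩ }

/-- The equivalence class `[A ⟶ B ⟶ Z]`. -/
def Seq.cls {A B Z : C} (x : A ⟶ B) (y : B ⟶ Z) : _root_.Quotient (Seq.setoid A Z) :=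
  _root_.Quotient.mk _ ⟨B, x, y⟩

end Sequences

/-- The structure of an extriangulated category `(C, 𝔼, 𝔰)` (Nakaoka–Palu) on an additive
category `C`. -/
structure ExtriangulatedStructure (C : Type u) [Category.{v} C] [Preadditive C]
    [HasZeroObject C] [HasBinaryBiproducts C] where
  /-- The bifunctor `𝔼 : Cᵒᵖ × C ⥤ Ab`, in curried form. -/
  E : Cᵒᵖ ⥤ C ⥤ AddCommGrpCat.{w}
  /-- (ET1), additivity in the second variable. -/
  additive_right (Z : Cᵒᵖ) : (E.obj Z).Additive
  /-- (ET1), additivity in the first variable. -/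
  additive_left (A : C) : (E.flip.obj A).Additive
  /-- The correspondence `𝔰`, sending an extension to an equivalence class of sequences. -/
  s {A Z : C} (δ : Ext E Z A) : _root_.Quotient (Seq.setoid A Z)
  /-- (ET2), `𝔰` is a realization: every morphism of extensions is realized by a triple. -/
  realization {A B Z A' B' Z' : C} {x : A ⟶ B} {y : B ⟶ Z} {x' : A' ⟶ B'} {y' : B' ⟶ Z'}
    {δ : Ext E Z A} {δ' : Ext E Z' A'} (hδ : s δ = Seq.cls x y) (hδ' : s δ' = Seq.cls x' y')
    (a : A ⟶ A') (c : Z ⟶ Z') (hac : IsExtHom δ δ' a c) :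
    ∃ b : B ⟶ B', x ≫ b = a ≫ x' ∧ y ≫ c = b ≫ y'
  /-- (ET2), `𝔰` sends the zero extension to the split sequence. -/
  s_zero (A Z : C) :
    s (0 : Ext E Z A) = Seq.cls (biprod.inl : A ⟶ A ⊞ Z) (biprod.snd : A ⊞ Z ⟶ Z)
  /-- (ET2), `𝔰` is compatible with direct sums. -/
  s_sum {A B Z A' B' Z' : C} {x : A ⟶ B} {y : B ⟶ Z} {x' : A' ⟶ B'} {y' : B' ⟶ Z'}
    {δ : Ext E Z A} {δ' : Ext E Z' A'} (hδ : s δ = Seq.cls x y) (hδ' : s δ' = Seq.cls x' y') :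
    s (extSum δ δ') = Seq.cls (biprod.map x x') (biprod.map y y')
  /-- (ET3) -/
  et3 {A B Z A' B' Z' : C} {x : A ⟶ B} {y : B ⟶ Z} {x' : A' ⟶ B'} {y' : B' ⟶ Z'}
    {δ : Ext E Z A} {δ' : Ext E Z' A'} (hδ : s δ = Seq.cls x y) (hδ' : s δ' = Seq.cls x' y')
    (a : A ⟶ A') (b : B ⟶ B') (hab : x ≫ b = a ≫ x') :
    ∃ c : Z ⟶ Z', y ≫ c = b ≫ y' ∧ IsExtHom δ δ' a c
  /-- (ET3)ᵒᵖ -/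
  et3_op {A B Z A' B' Z' : C} {x : A ⟶ B} {y : B ⟶ Z} {x' : A' ⟶ B'} {y' : B' ⟶ Z'}
    {δ : Ext E Z A} {δ' : Ext E Z' A'} (hδ : s δ = Seq.cls x y) (hδ' : s δ' = Seq.cls x' y')
    (b : B ⟶ B') (c : Z ⟶ Z') (hbc : y ≫ c = b ≫ y') :
    ∃ a : A ⟶ A', x ≫ b = a ≫ x' ∧ IsExtHom δ δ' a c
  /-- (ET4) -/
  et4 {A B D X F : C} {f : A ⟶ B} {f' : B ⟶ D} {g : B ⟶ X} {g' : X ⟶ F}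
    {δ : Ext E D A} {δ' : Ext E F B} (hδ : s δ = Seq.cls f f') (hδ' : s δ' = Seq.cls g g') :
    ∃ (G : C) (h : A ⟶ X) (h' : X ⟶ G) (d : D ⟶ G) (e : G ⟶ F) (δ'' : Ext E G A),
      h = f ≫ g ∧ f' ≫ d = g ≫ h' ∧ h' ≫ e = g' ∧
      s δ'' = Seq.cls h h' ∧ s (push f' δ') = Seq.cls d e ∧
      δ = pull d δ'' ∧ push f δ'' = pull e δ'
  /-- (ET4)ᵒᵖ -/
  et4_op {D A B F X : C} {f' : D ⟶ A} {f : A ⟶ B} {g' : F ⟶ B} {g : B ⟶ X}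
    {δ : Ext E B D} {δ' : Ext E X F} (hδ : s δ = Seq.cls f' f) (hδ' : s δ' = Seq.cls g' g) :
    ∃ (G : C) (d : D ⟶ G) (e : G ⟶ F) (h' : G ⟶ A) (h : A ⟶ X) (δ'' : Ext E X G),
      d ≫ h' = f' ∧ h' ≫ f = e ≫ g' ∧ h = f ≫ g ∧
      s (pull g' δ) = Seq.cls d e ∧ s δ'' = Seq.cls h' h ∧
      δ' = push e δ'' ∧ push d δ = pull g δ''

variable {C : Type u} [Category.{v} C] [Preadditive C] [HasZeroObject C] [HasBinaryBiproducts C]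

namespace ExtriangulatedStructure

variable (S : ExtriangulatedStructure.{w} C)

/-- `A ⟶ B ⟶ Z ⇢ δ` is an `𝔰`-triangle. -/
def IsTriangle {A B Z : C} (x : A ⟶ B) (y : B ⟶ Z) (δ : Ext S.E Z A) : Prop :=
  S.s δ = Seq.cls x y

section

variable {S}

lemma push_id {Z A : C} (δ : Ext S.E Z A) : push (𝟙 A) δ = δ := by simp [push]

lemma pull_id {Z A : C} (δ : Ext S.E Z A) : pull (𝟙 Z) δ = δ := by simp [pull]

lemma push_comp {Z A A' A'' : C} (a : A ⟶ A') (a' : A' ⟶ A'') (δ : Ext S.E Z A) :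
    push (a ≫ a') δ = push a' (push a δ) := by simp [push]

lemma pull_comp {Z Z' Z'' A : C} (c' : Z'' ⟶ Z') (c : Z' ⟶ Z) (δ : Ext S.E Z A) :
    pull (c' ≫ c) δ = pull c' (pull c δ) := by simp [pull]

lemma push_pull {Z Z' A A' : C} (a : A ⟶ A') (c : Z' ⟶ Z) (δ : Ext S.E Z A) :
    push a (pull c δ) = pull c (push a δ) :=
  (ConcreteCategory.congr_hom ((S.E.map c.op).naturality a) δ).symm

lemma push_add {Z A A' : C} (a b : A ⟶ A') (δ : Ext S.E Z A) :
    push (a + b) δ = push a δ + push b δ := by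
  have := S.additive_right (op Z)
  simp [push, Functor.map_add]

lemma push_neg {Z A A' : C} (a : A ⟶ A') (δ : Ext S.E Z A) :
    push (-a) δ = -push a δ := by
  have := S.additive_right (op Z)
  simp [push, Functor.map_neg]

lemma push_zero {Z A A' : C} (δ : Ext S.E Z A) : push (0 : A ⟶ A') δ = 0 := by
  have := S.additive_right (op Z)
  simp [push]

lemma pull_add {Z Z' A : C} (c d : Z' ⟶ Z) (δ : Ext S.E Z A) :
    pull (c + d) δ = pull c δ + pull d δ := by
  have := S.additive_left A
  have h := (S.E.flip.obj A).map_add (f := c.op) (g := d.op)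
  exact ConcreteCategory.congr_hom h δ

lemma pull_neg {Z Z' A : C} (c : Z' ⟶ Z) (δ : Ext S.E Z A) :
    pull (-c) δ = -pull c δ := by
  have := S.additive_left A
  have h := (S.E.flip.obj A).map_neg (f := c.op)
  exact ConcreteCategory.congr_hom h δ

lemma pull_zero {Z Z' A : C} (δ : Ext S.E Z A) : pull (0 : Z' ⟶ Z) δ = 0 := by
  have := S.additive_left A
  have h := (S.E.flip.obj A).map_zero (op Z) (op Z')
  exact ConcreteCategory.congr_hom h δ

end

/-- The objects of `𝔰-tri(C)`: the `𝔰`-triangles `X₁ ⟶ X₂ ⟶ X₃ ⇢ δ`. -/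
structure Tri where
  X₁ : C
  X₂ : C
  X₃ : C
  f₁ : X₁ ⟶ X₂
  f₂ : X₂ ⟶ X₃
  δ : Ext S.E X₃ X₁
  isTriangle : S.IsTriangle f₁ f₂ δ

namespace Tri

variable {S}

/-- Morphisms of `𝔰`-triangles. -/
@[ext]
structure Hom (X Y : S.Tri) where
  φ₁ : X.X₁ ⟶ Y.X₁
  φ₂ : X.X₂ ⟶ Y.X₂
  φ₃ : X.X₃ ⟶ Y.X₃
  comm₁ : X.f₁ ≫ φ₂ = φ₁ ≫ Y.f₁
  comm₂ : X.f₂ ≫ φ₃ = φ₂ ≫ Y.f₂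
  ext_comm : IsExtHom X.δ Y.δ φ₁ φ₃

/-- The category `𝔰-tri(C)`. -/
instance : Category S.Tri where
  Hom X Y := Hom X Y
  id X :=
    { φ₁ := 𝟙 _, φ₂ := 𝟙 _, φ₃ := 𝟙 _
      comm₁ := by simp
      comm₂ := by simp
      ext_comm := by simp [IsExtHom, push_id, pull_id] }
  comp φ ψ :=
    { φ₁ := φ.φ₁ ≫ ψ.φ₁
      φ₂ := φ.φ₂ ≫ ψ.φ₂
      φ₃ := φ.φ₃ ≫ ψ.φ₃
      comm₁ := by rw [← Category.assoc, φ.comm₁, Category.assoc, ψ.comm₁, Category.assoc]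
      comm₂ := by rw [← Category.assoc, φ.comm₂, Category.assoc, ψ.comm₂, Category.assoc]
      ext_comm := by
        have h₁ := φ.ext_comm
        have h₂ := ψ.ext_comm
        simp only [IsExtHom] at h₁ h₂ ⊢
        rw [push_comp, h₁, push_pull, h₂, ← pull_comp] }
  id_comp φ := by apply Hom.ext <;> simp
  comp_id φ := by apply Hom.ext <;> simp
  assoc φ ψ χ := by apply Hom.ext <;> simp

@[ext]
lemma hom_ext {X Y : S.Tri} {φ ψ : X ⟶ Y} (h₁ : φ.φ₁ = ψ.φ₁) (h₂ : φ.φ₂ = ψ.φ₂)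
    (h₃ : φ.φ₃ = ψ.φ₃) : φ = ψ :=
  Hom.ext h₁ h₂ h₃

@[simp] lemma comp_φ₁ {X Y Z : S.Tri} (φ : X ⟶ Y) (ψ : Y ⟶ Z) : (φ ≫ ψ).φ₁ = φ.φ₁ ≫ ψ.φ₁ := rfl
@[simp] lemma comp_φ₂ {X Y Z : S.Tri} (φ : X ⟶ Y) (ψ : Y ⟶ Z) : (φ ≫ ψ).φ₂ = φ.φ₂ ≫ ψ.φ₂ := rfl
@[simp] lemma comp_φ₃ {X Y Z : S.Tri} (φ : X ⟶ Y) (ψ : Y ⟶ Z) : (φ ≫ ψ).φ₃ = φ.φ₃ ≫ ψ.φ₃ := rfl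

section Additive

variable {X Y : S.Tri}

instance : Zero (X ⟶ Y) where
  zero :=
    { φ₁ := 0, φ₂ := 0, φ₃ := 0
      comm₁ := by simp
      comm₂ := by simp
      ext_comm := by simp [IsExtHom, push_zero, pull_zero] }

instance : Add (X ⟶ Y) where
  add φ ψ :=
    { φ₁ := φ.φ₁ + ψ.φ₁
      φ₂ := φ.φ₂ + ψ.φ₂
      φ₃ := φ.φ₃ + ψ.φ₃
      comm₁ := by simp [φ.comm₁, ψ.comm₁]
      comm₂ := by simp [φ.comm₂, ψ.comm₂]
      ext_comm := by
        have h₁ := φ.ext_comm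
        have h₂ := ψ.ext_comm
        simp only [IsExtHom] at h₁ h₂ ⊢
        rw [push_add, pull_add, h₁, h₂] }

instance : Neg (X ⟶ Y) where
  neg φ :=
    { φ₁ := -φ.φ₁
      φ₂ := -φ.φ₂
      φ₃ := -φ.φ₃
      comm₁ := by simp [φ.comm₁]
      comm₂ := by simp [φ.comm₂]
      ext_comm := by
        have h₁ := φ.ext_comm
        simp only [IsExtHom] at h₁ ⊢
        rw [push_neg, pull_neg, h₁] }

@[simp] lemma zero_φ₁ : (0 : X ⟶ Y).φ₁ = 0 := rfl
@[simp] lemma zero_φ₂ : (0 : X ⟶ Y).φ₂ = 0 := rfl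
@[simp] lemma zero_φ₃ : (0 : X ⟶ Y).φ₃ = 0 := rfl
@[simp] lemma add_φ₁ (φ ψ : X ⟶ Y) : (φ + ψ).φ₁ = φ.φ₁ + ψ.φ₁ := rfl
@[simp] lemma add_φ₂ (φ ψ : X ⟶ Y) : (φ + ψ).φ₂ = φ.φ₂ + ψ.φ₂ := rfl
@[simp] lemma add_φ₃ (φ ψ : X ⟶ Y) : (φ + ψ).φ₃ = φ.φ₃ + ψ.φ₃ := rfl
@[simp] lemma neg_φ₁ (φ : X ⟶ Y) : (-φ).φ₁ = -φ.φ₁ := rfl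
@[simp] lemma neg_φ₂ (φ : X ⟶ Y) : (-φ).φ₂ = -φ.φ₂ := rfl
@[simp] lemma neg_φ₃ (φ : X ⟶ Y) : (-φ).φ₃ = -φ.φ₃ := rfl

instance : AddCommGroup (X ⟶ Y) where
  add_assoc φ ψ χ := by ext <;> simp [add_assoc]
  zero_add φ := by ext <;> simp
  add_zero φ := by ext <;> simp
  neg_add_cancel φ := by ext <;> simp
  add_comm φ ψ := by ext <;> simp [add_comm]
  nsmul := nsmulRec
  zsmul := zsmulRec

end Additive

/-- Componentwise addition makes `𝔰-tri(C)` a preadditive category. -/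
instance : Preadditive S.Tri where
  homGroup X Y := inferInstance
  add_comp X Y Z φ ψ χ := by ext <;> simp
  comp_add X Y Z φ ψ χ := by ext <;> simp

@[simp] lemma sub_φ₃ {X Y : S.Tri} (φ ψ : X ⟶ Y) : (φ - ψ).φ₃ = φ.φ₃ - ψ.φ₃ := by
  simp [sub_eq_add_neg]

/-- `φ ∈ 𝓡₂(X, Y)`: the third component of `φ` factors through the deflation of `Y`. -/
def MemR₂ {X Y : S.Tri} (φ : X ⟶ Y) : Prop :=
  ∃ p : X.X₃ ⟶ Y.X₂, p ≫ Y.f₂ = φ.φ₃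

end Tri

/-- The congruence on `𝔰-tri(C)` attached to the ideal `𝓡₂`. -/
def R₂ : HomRel S.Tri := fun _ _ φ ψ => Tri.MemR₂ (φ - ψ)

instance : Congruence S.R₂ where
  comp_left := by
    rintro X Y Z φ ψ χ ⟨p, hp⟩
    exact ⟨φ.φ₃ ≫ p, by simpa using congrArg (fun t => φ.φ₃ ≫ t) hp⟩
  comp_right := by
    rintro X Y Z φ ψ χ ⟨p, hp⟩
    refine ⟨p ≫ χ.φ₂, ?_⟩
    have h := congrArg (fun t => t ≫ χ.φ₃) hp
    simpa [χ.comm₂] using h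
  equivalence :=
    { refl := fun φ => ⟨0, by simp⟩
      symm := by
        rintro φ ψ ⟨p, hp⟩
        exact ⟨-p, by simp [hp]⟩
      trans := by
        rintro φ ψ χ ⟨p, hp⟩ ⟨q, hq⟩
        exact ⟨p + q, by simp [hp, hq]⟩ }

/-- The ideal quotient `𝔰-tri(C)/𝓡₂`. -/
abbrev TriQuot := CategoryTheory.Quotient S.R₂

/-- The addition on `𝔰-tri(C)/𝓡₂` induced from `𝔰-tri(C)`. -/
instance preadditiveTriQuot : Preadditive S.TriQuot :=
  Quotient.preadditive S.R₂ (by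
    rintro X Y φ₁ φ₂ ψ₁ ψ₂ ⟨p, hp⟩ ⟨q, hq⟩
    exact ⟨p + q, by simp [hp, hq]; abel⟩)

/-- The projection `𝔰-tri(C) ⥤ 𝔰-tri(C)/𝓡₂`, `φ ↦ φ̲`. -/
abbrev proj : S.Tri ⥤ S.TriQuot := Quotient.functor S.R₂

lemma proj_map_eq_zero_iff {X Y : S.Tri} (φ : X ⟶ Y) : S.proj.map φ = 0 ↔ Tri.MemR₂ φ := by
  have h := Quotient.functor_map_eq_iff S.R₂ φ 0
  rw [R₂, sub_zero] at h
  exact h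

variable {S}

/-- For a morphism `φ : X ⟶ Y` of `𝔰`-triangles and a sequence `Y₁ ⟶ Z ⟶ X₃` realizing
`φ₁_* δ = φ₃^* δ'`: a choice of `a₁ : X₂ ⟶ Z` and `a₂ : Z ⟶ Y₂` that factors `φ` up to `𝓡₂` as
`(φ₁, a₁, 1)` followed by `(1, a₂, φ₃)`, and for which the two sequences
`X₁ ⟶ X₂ ⊞ Y₁ ⟶ Z ⇢ h₂^* δ` and `Z ⟶ X₃ ⊞ Y₂ ⟶ Y₃ ⇢ h₁_* δ'` are `𝔰`-triangles. -/
structure FactorData {X Y : S.Tri} (φ : X ⟶ Y) {Z : C} (h₁ : Y.X₁ ⟶ Z) (h₂ : Z ⟶ X.X₃) where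
  a₁ : X.X₂ ⟶ Z
  a₂ : Z ⟶ Y.X₂
  f₁_a₁ : X.f₁ ≫ a₁ = φ.φ₁ ≫ h₁
  a₁_h₂ : a₁ ≫ h₂ = X.f₂
  h₁_a₂ : h₁ ≫ a₂ = Y.f₁
  a₂_f₂ : a₂ ≫ Y.f₂ = h₂ ≫ φ.φ₃
  triI : S.IsTriangle h₁ h₂ (push φ.φ₁ X.δ)
  triK : S.IsTriangle (biprod.lift X.f₁ φ.φ₁) (biprod.desc a₁ (-h₁)) (pull h₂ X.δ)
  triC : S.IsTriangle (biprod.lift h₂ a₂) (biprod.desc (-φ.φ₃) Y.f₂) (push h₁ Y.δ)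

namespace FactorData

variable {X Y : S.Tri} {φ : X ⟶ Y} {Z : C} {h₁ : Y.X₁ ⟶ Z} {h₂ : Z ⟶ X.X₃}
  (D : FactorData φ h₁ h₂)

lemma h₁_h₂ (D : FactorData φ h₁ h₂) : h₁ ≫ h₂ = 0 := by
  obtain ⟨a, ha, ha'⟩ := S.realization (S.s_zero Y.X₁ X.X₃) D.triI (𝟙 _) 0
    (by simp [IsExtHom, push_id, pull_zero])
  have h := congrArg (fun t => biprod.inl ≫ t) ha'
  simp only [comp_zero] at h
  rw [← Category.assoc, ha, Category.id_comp] at h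
  exact h.symm

/-- The kernel object `K(φ) = (X₁ ⟶ X₂ ⊞ Y₁ ⟶ Z ⇢ h₂^* δ)`. -/
noncomputable def K : S.Tri where
  X₁ := X.X₁
  X₂ := X.X₂ ⊞ Y.X₁
  X₃ := Z
  f₁ := biprod.lift X.f₁ φ.φ₁
  f₂ := biprod.desc D.a₁ (-h₁)
  δ := pull h₂ X.δ
  isTriangle := D.triK

/-- The image object `I(φ) = (Y₁ ⟶ Z ⟶ X₃ ⇢ φ₁_* δ)`. -/
def I : S.Tri where
  X₁ := Y.X₁
  X₂ := Z
  X₃ := X.X₃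
  f₁ := h₁
  f₂ := h₂
  δ := push φ.φ₁ X.δ
  isTriangle := D.triI

/-- The cokernel object `C(φ) = (Z ⟶ X₃ ⊞ Y₂ ⟶ Y₃ ⇢ h₁_* δ')`. -/
noncomputable def Q : S.Tri where
  X₁ := Z
  X₂ := X.X₃ ⊞ Y.X₂
  X₃ := Y.X₃
  f₁ := biprod.lift h₂ D.a₂
  f₂ := biprod.desc (-φ.φ₃) Y.f₂
  δ := push h₁ Y.δ
  isTriangle := D.triC

/-- `k = (1, (1, 0), h₂) : K(φ) ⟶ X`. -/
noncomputable def k : D.K ⟶ X where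
  φ₁ := 𝟙 X.X₁
  φ₂ := (biprod.fst : X.X₂ ⊞ Y.X₁ ⟶ X.X₂)
  φ₃ := h₂
  comm₁ := by simp [K]
  comm₂ := by
    apply biprod.hom_ext' <;> simp [K, D.a₁_h₂, D.h₁_h₂]
  ext_comm := push_id (S := S) (pull h₂ X.δ)

/-- `π = (φ₁, a₁, 1) : X ⟶ I(φ)`. -/
def π : X ⟶ D.I where
  φ₁ := φ.φ₁
  φ₂ := D.a₁
  φ₃ := 𝟙 X.X₃
  comm₁ := D.f₁_a₁
  comm₂ := (Category.comp_id _).trans D.a₁_h₂.symm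
  ext_comm := (pull_id (S := S) (push φ.φ₁ X.δ)).symm

/-- `i = (1, a₂, φ₃) : I(φ) ⟶ Y`. -/
def i : D.I ⟶ Y where
  φ₁ := 𝟙 Y.X₁
  φ₂ := D.a₂
  φ₃ := φ.φ₃
  comm₁ := D.h₁_a₂.trans (Category.id_comp _).symm
  comm₂ := D.a₂_f₂.symm
  ext_comm := (push_id (S := S) (push φ.φ₁ X.δ)).trans φ.ext_comm

/-- `c = (h₁, (0, 1)ᵗ, 1) : Y ⟶ C(φ)`. -/
noncomputable def c : Y ⟶ D.Q where
  φ₁ := h₁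
  φ₂ := (biprod.inr : Y.X₂ ⟶ X.X₃ ⊞ Y.X₂)
  φ₃ := 𝟙 Y.X₃
  comm₁ := by
    apply biprod.hom_ext <;> simp [Q, D.h₁_a₂, D.h₁_h₂]
  comm₂ := by simp [Q]
  ext_comm := (pull_id (S := S) (push h₁ Y.δ)).symm

end FactorData

end ExtriangulatedStructure

end Extriangulated

open scoped ZeroObject

namespace Extriangulated

namespace ExtriangulatedStructure

variable {C : Type u} [Category.{v} C] [Preadditive C] [HasZeroObject C] [HasBinaryBiproducts C]
  {S : ExtriangulatedStructure.{w} C}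

/-! The long exact sequences of an `𝔰`-triangle, together with `φ₁_* δ = φ₃^* δ'`, make `𝓡₂`
self-dual: `φ₃` factors through the deflation of `Y` iff this common extension vanishes, iff `φ₁`
factors through the inflation of `X` (`Tri.memR₂_iff_exists`). So a class in the quotient is
determined by `φ₃` alone and also by `φ₁` alone. A morphism with invertible `φ₁` becomes mono, and
one with invertible `φ₃` becomes epi.

Realizing the common extension factors `φ` as `π` followed by `i`. The homotopy pushout and homotopy
pullback through `Z` (`IsTriangle.exists_pushout`, `IsTriangle.exists_pullback`), obtained from
(ET4) and its dual, provide `K(φ)` and `C(φ)`. Since `k`, `i` are mono and `π`, `c` are epi in the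
quotient, only existence of factorizations remains. For `k` and `c` it comes from exactness of the
opposite triangle, `C(φ)` and `K(φ)` respectively. For `π` and `i` it comes from splitting a map on
or into a biproduct.

If `φ̲` is mono then `k̲ = 0`, so `π̲`, its cokernel, is invertible and `φ̲` is a kernel along with
`i̲`; epis are dual. -/

lemma push_map_zero {Z A A' : C} (a : A ⟶ A') : push a (0 : Ext S.E Z A) = 0 := by
  simp [push]

lemma pull_map_zero {Z Z' A : C} (c : Z' ⟶ Z) : pull c (0 : Ext S.E Z A) = 0 := by
  simp [pull]

lemma push_map_add {Z A A' : C} (a : A ⟶ A') (δ ε : Ext S.E Z A) :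
    push a (δ + ε) = push a δ + push a ε := by
  simp [push]

lemma pull_map_add {Z Z' A : C} (c : Z' ⟶ Z) (δ ε : Ext S.E Z A) :
    pull c (δ + ε) = pull c δ + pull c ε := by
  simp [pull]

/-- Every extension is realized by some `𝔰`-triangle. -/
lemma exists_isTriangle {A Z : C} (δ : Ext S.E Z A) :
    ∃ (B : C) (x : A ⟶ B) (y : B ⟶ Z), S.IsTriangle x y δ := by
  obtain ⟨T, hT⟩ := _root_.Quotient.exists_rep (S.s δ)
  exact ⟨T.mid, T.inf, T.defl, hT.symm⟩

lemma isTriangle_split (A Z : C) :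
    S.IsTriangle (biprod.inl : A ⟶ A ⊞ Z) (biprod.snd : A ⊞ Z ⟶ Z) (0 : Ext S.E Z A) :=
  S.s_zero A Z

/-! ### Exactness properties of an `𝔰`-triangle. -/

namespace IsTriangle

section

variable {A B Z : C} {x : A ⟶ B} {y : B ⟶ Z} {δ : Ext S.E Z A}

lemma of_iso (h : S.IsTriangle x y δ) {B' : C} {x' : A ⟶ B'} {y' : B' ⟶ Z} (b : B ≅ B')
    (hx : x ≫ b.hom = x') (hy : b.hom ≫ y' = y) : S.IsTriangle x' y' δ :=
  Eq.trans h (_root_.Quotient.sound ⟨b, hx, hy⟩)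

lemma exists_iso (h : S.IsTriangle x y δ) {B' : C} {x' : A ⟶ B'} {y' : B' ⟶ Z}
    (h' : S.IsTriangle x' y' δ) : ∃ b : B ≅ B', x ≫ b.hom = x' ∧ b.hom ≫ y' = y :=
  _root_.Quotient.exact (Eq.trans (Eq.symm h) h')

/-- Map the split triangle with left end `0` and right end `B` to the given one: (ET3)ᵒᵖ writes `y^*
δ` as the image of the zero extension. The neighbouring lemmas also compare with split triangles. -/
lemma pull_defl (h : S.IsTriangle x y δ) : pull y δ = 0 := by
  obtain ⟨a, -, ha⟩ := S.et3_op (S.s_zero 0 B) h biprod.snd y rfl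
  rw [← ha, push_map_zero]

lemma push_inf (h : S.IsTriangle x y δ) : push x δ = 0 := by
  obtain ⟨c, -, hc⟩ := S.et3 h (S.s_zero B 0) x biprod.inl rfl
  rw [hc, pull_map_zero]

lemma exists_lift_inf (h : S.IsTriangle x y δ) {T : C} (t : T ⟶ B) (ht : t ≫ y = 0) :
    ∃ r : T ⟶ A, r ≫ x = t := by
  obtain ⟨a, ha, -⟩ := S.et3_op (S.s_zero T 0) h (biprod.fst ≫ t) 0 (by simp [ht])
  exact ⟨a, by simpa using ha.symm⟩

lemma exists_desc_defl (h : S.IsTriangle x y δ) {T : C} (t : B ⟶ T) (ht : x ≫ t = 0) :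
    ∃ r : Z ⟶ T, y ≫ r = t := by
  obtain ⟨c, hc, -⟩ := S.et3 h (S.s_zero 0 T) 0 (t ≫ biprod.inr) (by simp [reassoc_of% ht])
  exact ⟨c, by simpa using hc⟩

lemma exists_lift_defl_iff (h : S.IsTriangle x y δ) {T : C} (c : T ⟶ Z) :
    (∃ r : T ⟶ B, r ≫ y = c) ↔ pull c δ = 0 := by
  constructor
  · rintro ⟨r, rfl⟩
    rw [pull_comp, h.pull_defl, pull_map_zero]
  · intro hc
    -- As `c^* δ = 0`, the pair `(1, c)` is a morphism from the split extension; its realization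
    -- restricted to the summand `T` is the lift.
    obtain ⟨b, -, hb⟩ := S.realization (S.s_zero A T) h (𝟙 A) c
      (by simp [IsExtHom, push_map_zero, hc])
    exact ⟨biprod.inr ≫ b, by simp [← hb]⟩

lemma exists_desc_inf_iff (h : S.IsTriangle x y δ) {T : C} (a : A ⟶ T) :
    (∃ r : B ⟶ T, x ≫ r = a) ↔ push a δ = 0 := by
  constructor
  · rintro ⟨r, rfl⟩
    rw [push_comp, h.push_inf, push_map_zero]
  · intro ha
    obtain ⟨b, hb, -⟩ := S.realization h (S.s_zero T Z) a (𝟙 Z)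
      (by simp [IsExtHom, pull_map_zero, ha])
    exact ⟨b ≫ biprod.fst, by simp [reassoc_of% hb]⟩

end

section

variable {A B Z A' B' Z' : C} {x : A ⟶ B} {y : B ⟶ Z} {δ : Ext S.E Z A}
  {x' : A' ⟶ B'} {y' : B' ⟶ Z'} {δ' : Ext S.E Z' A'}

/-- If the outer components of a morphism of `𝔰`-triangles are isomorphisms, so is the middle
one. -/
lemma isIso_mid (h : S.IsTriangle x y δ) (h' : S.IsTriangle x' y' δ') {a : A ⟶ A'} {b : B ⟶ B'}
    {c : Z ⟶ Z'} [IsIso a] [IsIso c] (hx : x ≫ b = a ≫ x') (hy : y ≫ c = b ≫ y')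
    (hac : IsExtHom δ δ' a c) : IsIso b := by
  have hac₁ : δ = push (inv a) (pull c δ') := by
    rw [← hac, ← push_comp, IsIso.hom_inv_id, push_id]
  have hac₂ : δ' = pull (inv c) (push a δ) := by
    rw [hac, ← pull_comp, IsIso.inv_hom_id, pull_id]
  -- A section of `b` up to an error killed by `y'`; the error factors through `x'` and is corrected
  -- by `r`. Dually, `s'` and `r'` give a retraction.
  obtain ⟨s, hs⟩ := (h.exists_lift_defl_iff (y' ≫ inv c)).2 (by
    rw [hac₁, ← push_pull, ← pull_comp, Category.assoc, IsIso.inv_hom_id, Category.comp_id,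
      h'.pull_defl, push_map_zero])
  obtain ⟨r, hr⟩ := h'.exists_lift_inf (𝟙 B' - s ≫ b) (by
    simp [← hy, reassoc_of% hs])
  obtain ⟨s', hs'⟩ := (h'.exists_desc_inf_iff (inv a ≫ x)).2 (by
    rw [hac₂, push_pull, ← push_comp, IsIso.hom_inv_id_assoc, h.push_inf, pull_map_zero])
  obtain ⟨r', hr'⟩ := h.exists_desc_defl (𝟙 B - b ≫ s') (by
    simp [reassoc_of% hx, hs'])
  have h₁ : (s + r ≫ inv a ≫ x) ≫ b = 𝟙 B' := by
    simp [hx, hr]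
  have h₂ : b ≫ (s' + y' ≫ inv c ≫ r') = 𝟙 B := by
    simp [← reassoc_of% hy, hr']
  exact ⟨_, h₂, by rw [← h₁]; exact congrArg (· ≫ b) (by
    rw [← Category.id_comp (s' + _), ← h₁, Category.assoc, h₂, Category.comp_id])⟩

end

/-! ### Changing the ends by isomorphisms and adding trivial summands. -/

variable {A B Z : C} {x : A ⟶ B} {y : B ⟶ Z} {δ : Ext S.E Z A}

/-- Any realization of the pulled-back extension maps to the given triangle with invertible ends, so
`isIso_mid` identifies the two. -/
lemma of_iso_right (h : S.IsTriangle x y δ) {Z' : C} (c : Z' ≅ Z) :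
    S.IsTriangle x (y ≫ c.inv) (pull c.hom δ) := by
  obtain ⟨B', x', y', h'⟩ := exists_isTriangle (pull c.hom δ)
  have hac : IsExtHom (pull c.hom δ) δ (𝟙 A) c.hom := by simp [IsExtHom, push_id]
  obtain ⟨b, hx, hy⟩ := S.realization h' h (𝟙 A) c.hom hac
  have := isIso_mid h' h hx hy hac
  exact h'.of_iso (asIso b) (by simpa using hx) (by simp [← reassoc_of% hy])

lemma of_iso_left (h : S.IsTriangle x y δ) {A' : C} (a : A ≅ A') :
    S.IsTriangle (a.inv ≫ x) y (push a.hom δ) := by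
  obtain ⟨B', x', y', h'⟩ := exists_isTriangle (push a.hom δ)
  have hac : IsExtHom δ (push a.hom δ) a.hom (𝟙 Z) := by simp [IsExtHom, pull_id]
  obtain ⟨b, hx, hy⟩ := S.realization h h' a.hom (𝟙 Z) hac
  have := isIso_mid h h' hx hy hac
  exact h'.of_iso (asIso b).symm (by simp [← cancel_mono b, hx]) (by
    simp [← cancel_epi b, ← hy])

/-- Add the split triangle with ends `T` and `0`, then remove the superfluous zero objects. -/
lemma map_id_right (h : S.IsTriangle x y δ) (T : C) :
    S.IsTriangle (biprod.map x (𝟙 T)) (biprod.fst ≫ y) (push biprod.inl δ : Ext S.E Z (A ⊞ T)) := by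
  let c : Z ≅ Z ⊞ 0 :=
    { hom := biprod.inl
      inv := biprod.fst
      inv_hom_id := by
        apply biprod.hom_ext'
        · simp
        · exact (isZero_zero C).eq_of_src _ _ }
  let t : T ⊞ 0 ≅ T :=
    { hom := biprod.fst
      inv := biprod.inl
      hom_inv_id := by
        apply biprod.hom_ext'
        · simp
        · exact (isZero_zero C).eq_of_src _ _ }
  have h₁ := of_iso_right (S.s_sum h (S.s_zero T 0)) c
  have h₂ : pull c.hom (extSum δ (0 : Ext S.E 0 T)) = push biprod.inl δ := by
    simp only [c, extSum]
    rw [pull_map_zero, push_map_zero, add_zero, ← push_pull, ← pull_comp, biprod.inl_fst, pull_id]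
  rw [h₂] at h₁
  exact h₁.of_iso (biprod.mapIso (Iso.refl B) t) (by apply biprod.hom_ext <;> simp [t])
    (by apply biprod.hom_ext' <;> simp [c])

lemma map_id_left (h : S.IsTriangle x y δ) (T : C) :
    S.IsTriangle (x ≫ biprod.inr) (biprod.map (𝟙 T) y) (pull biprod.snd δ : Ext S.E (T ⊞ Z) A) := by
  let a : 0 ⊞ A ≅ A :=
    { hom := biprod.snd
      inv := biprod.inr
      hom_inv_id := by
        apply biprod.hom_ext'
        · exact (isZero_zero C).eq_of_src _ _
        · simp }
  let t : 0 ⊞ T ≅ T :=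
    { hom := biprod.snd
      inv := biprod.inr
      hom_inv_id := by
        apply biprod.hom_ext'
        · exact (isZero_zero C).eq_of_src _ _
        · simp }
  have h₁ := of_iso_left (S.s_sum (S.s_zero 0 T) h) a
  have h₂ : push a.hom (extSum (0 : Ext S.E T 0) δ) = pull biprod.snd δ := by
    simp only [a, extSum]
    rw [pull_map_zero, push_map_zero, zero_add, ← push_comp, biprod.inr_snd, push_id]
  rw [h₂] at h₁
  exact h₁.of_iso (biprod.mapIso t (Iso.refl B)) (by apply biprod.hom_ext <;> simp [a])
    (by apply biprod.hom_ext' <;> simp [t])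

end IsTriangle

/-! ### Homotopy pushouts and pullbacks from (ET4). -/

lemma isTriangle_graph_desc {A D : C} (φ : A ⟶ D) :
    S.IsTriangle (biprod.lift (𝟙 A) φ) (biprod.desc φ (-𝟙 D)) (0 : Ext S.E D A) := by
  -- The involution `(u, v) ↦ (u, φ u - v)` carries the split triangle to the graph of `φ` with the
  -- signs used in `K(φ)`.
  let b : A ⊞ D ≅ A ⊞ D :=
    { hom := biprod.desc (biprod.lift (𝟙 A) φ) (-biprod.inr)
      inv := biprod.desc (biprod.lift (𝟙 A) φ) (-biprod.inr)
      hom_inv_id := by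
        apply biprod.hom_ext' <;> apply biprod.hom_ext <;> simp [biprod.lift_desc]
      inv_hom_id := by
        apply biprod.hom_ext' <;> apply biprod.hom_ext <;> simp [biprod.lift_desc] }
  exact (isTriangle_split A D).of_iso b (by simp [b])
    (by apply biprod.hom_ext' <;> simp [b, biprod.lift_desc])

lemma isTriangle_graph_desc_neg {A D : C} (φ : A ⟶ D) :
    S.IsTriangle (biprod.lift (𝟙 A) φ) (biprod.desc (-φ) (𝟙 D)) (0 : Ext S.E D A) := by
  let b : A ⊞ D ≅ A ⊞ D :=
    { hom := biprod.desc (biprod.lift (𝟙 A) φ) biprod.inr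
      inv := biprod.desc (biprod.lift (𝟙 A) (-φ)) biprod.inr
      hom_inv_id := by
        apply biprod.hom_ext' <;> apply biprod.hom_ext <;> simp [biprod.lift_desc]
      inv_hom_id := by
        apply biprod.hom_ext' <;> apply biprod.hom_ext <;> simp [biprod.lift_desc] }
  exact (isTriangle_split A D).of_iso b (by simp [b])
    (by apply biprod.hom_ext' <;> simp [b, biprod.lift_desc])

/-- The homotopy pushout of an inflation: for `𝔰`-triangles realizing `δ` and `a_* δ`, a suitable
filler `B ⟶ M` yields an `𝔰`-triangle `A ⟶ B ⊞ D ⟶ M`. -/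
lemma IsTriangle.exists_pushout {A B Z D M : C} {x : A ⟶ B} {y : B ⟶ Z} {δ : Ext S.E Z A}
    (h : S.IsTriangle x y δ) (a : A ⟶ D) {m : D ⟶ M} {e : M ⟶ Z}
    (h' : S.IsTriangle m e (push a δ)) :
    ∃ g : B ⟶ M, x ≫ g = a ≫ m ∧ g ≫ e = y ∧
      S.IsTriangle (biprod.lift x a) (biprod.desc g (-m)) (pull e δ) := by
  -- (ET4) for the graph `A ⟶ A ⊞ D` followed by `x ⊕ 1`, whose composite is `(x, a)`. The induced
  -- triangle `D ⟶ G ⟶ Z` realizes `a_* δ`, so `G` may be replaced by `M`.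
  obtain ⟨G, k, k', d, e', ε, hk, hd, he, hε, hde, -, hpush⟩ :=
    S.et4 (isTriangle_graph_desc (S := S) a) (h.map_id_right D)
  rw [← push_comp, biprod.inl_desc] at hde
  obtain ⟨b, hb₁, hb₂⟩ := IsTriangle.exists_iso hde h'
  have hk₁ : k = biprod.lift x a := by rw [hk]; apply biprod.hom_ext <;> simp
  have hinl := congrArg (biprod.inl ≫ ·) hd
  have hinr := congrArg (biprod.inr ≫ ·) hd
  simp at hinl hinr
  -- Projecting the last identity of (ET4) to the summand `A` determines `ε`.
  have hε' : ε = pull e' δ := by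
    have := congrArg (push biprod.fst) hpush
    rwa [← push_comp, biprod.lift_fst, push_id, push_pull, ← push_comp, biprod.inl_fst,
      push_id] at this
  subst hε'
  have hT := (IsTriangle.of_iso_right hε b.symm)
  have hdesc : k' ≫ b.hom = biprod.desc (biprod.inl ≫ k' ≫ b.hom) (-m) := by
    apply biprod.hom_ext'
    · simp
    · simp [← hb₁, ← reassoc_of% hinr]
  refine ⟨biprod.inl ≫ k' ≫ b.hom, ?_, ?_, ?_⟩
  · rw [← hb₁, reassoc_of% hinl]
  · simp [hb₂, he]
  · rw [← hdesc, ← hk₁]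
    rwa [← pull_comp, ← hb₂, Iso.symm_hom, Iso.inv_hom_id_assoc] at hT

/-- The homotopy pullback of a deflation: for `𝔰`-triangles realizing `δ` and `c^* δ`, a suitable
filler `M ⟶ B` yields an `𝔰`-triangle `M ⟶ W ⊞ B ⟶ Z`. -/
lemma IsTriangle.exists_pullback {A B Z W M : C} {x : A ⟶ B} {y : B ⟶ Z} {δ : Ext S.E Z A}
    (h : S.IsTriangle x y δ) (c : W ⟶ Z) {m : A ⟶ M} {e : M ⟶ W}
    (h' : S.IsTriangle m e (pull c δ)) :
    ∃ g : M ⟶ B, m ≫ g = x ∧ g ≫ y = e ≫ c ∧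
      S.IsTriangle (biprod.lift e g) (biprod.desc (-c) y) (push m δ) := by
  -- Dually, (ET4)ᵒᵖ for `1 ⊕ y` followed by `(-c, 1)`, whose kernel-side inflation is the graph of
  -- `c`.
  obtain ⟨G, d, e', k', k, ε, hd, he, hk, hde, hε, -, hpull⟩ :=
    S.et4_op (h.map_id_left W) (isTriangle_graph_desc_neg (S := S) c)
  rw [← pull_comp, biprod.lift_snd] at hde
  obtain ⟨b, hb₁, hb₂⟩ := IsTriangle.exists_iso h' hde
  have hk₁ : k = biprod.desc (-c) y := by rw [hk]; apply biprod.hom_ext' <;> simp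
  have hfst := congrArg (· ≫ biprod.fst) he
  have hsnd := congrArg (· ≫ biprod.snd) he
  simp at hfst hsnd
  have hε' : ε = push d δ := by
    have := congrArg (pull biprod.inr) hpull
    rw [← pull_comp, biprod.inr_desc, pull_id, ← push_pull, ← pull_comp, biprod.inr_snd,
      pull_id] at this
    exact this.symm
  subst hε'
  have hT := (IsTriangle.of_iso_left hε b.symm)
  have hlift : b.hom ≫ k' = biprod.lift e (b.hom ≫ k' ≫ biprod.snd) := by
    apply biprod.hom_ext
    · simp [hfst, hb₂]
    · simp
  refine ⟨b.hom ≫ k' ≫ biprod.snd, ?_, ?_, ?_⟩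
  · rw [reassoc_of% hb₁, reassoc_of% hd]; simp
  · simp [hsnd, ← reassoc_of% hb₂]
  · rw [← hlift, ← hk₁]
    rwa [← push_comp, ← hb₁, Iso.symm_hom, Category.assoc, Iso.hom_inv_id, Category.comp_id] at hT

/-- Every realization of `φ₁_* δ` underlies a factorization of `φ`. -/
lemma nonempty_factorData {X Y : S.Tri} (φ : X ⟶ Y) {Z : C} (h₁ : Y.X₁ ⟶ Z) (h₂ : Z ⟶ X.X₃)
    (h : S.IsTriangle h₁ h₂ (push φ.φ₁ X.δ)) : Nonempty (FactorData φ h₁ h₂) := by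
  obtain ⟨a₁, h₃, h₄, h₅⟩ := X.isTriangle.exists_pushout φ.φ₁ h
  -- The same `Z` serves for the pullback because `φ₁_* δ = φ₃^* δ'`.
  obtain ⟨a₂, h₆, h₇, h₈⟩ := Y.isTriangle.exists_pullback φ.φ₃ (m := h₁) (e := h₂) (by
    rw [← show push φ.φ₁ X.δ = pull φ.φ₃ Y.δ from φ.ext_comm]; exact h)
  exact ⟨⟨a₁, a₂, h₃, h₄, h₆, h₇, h, h₅, h₈⟩⟩

/-! ### The ideal `𝓡₂` and criteria in the quotient. -/

namespace Tri

lemma memR₂_iff_pull {X Y : S.Tri} (φ : X ⟶ Y) : MemR₂ φ ↔ pull φ.φ₃ Y.δ = 0 :=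
  Y.isTriangle.exists_lift_defl_iff φ.φ₃

lemma memR₂_iff_push {X Y : S.Tri} (φ : X ⟶ Y) : MemR₂ φ ↔ push φ.φ₁ X.δ = 0 := by
  rw [memR₂_iff_pull, ← show push φ.φ₁ X.δ = pull φ.φ₃ Y.δ from φ.ext_comm]

lemma memR₂_iff_exists {X Y : S.Tri} (φ : X ⟶ Y) :
    MemR₂ φ ↔ ∃ p : X.X₂ ⟶ Y.X₁, X.f₁ ≫ p = φ.φ₁ := by
  rw [memR₂_iff_push, X.isTriangle.exists_desc_inf_iff]

/-- A morphism of extensions extends to a morphism of `𝔰`-triangles. -/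
lemma exists_hom {X Y : S.Tri} (a : X.X₁ ⟶ Y.X₁) (c : X.X₃ ⟶ Y.X₃)
    (h : push a X.δ = pull c Y.δ) : ∃ φ : X ⟶ Y, φ.φ₁ = a ∧ φ.φ₃ = c := by
  obtain ⟨b, hb, hb'⟩ := S.realization X.isTriangle Y.isTriangle a c h
  exact ⟨⟨a, b, c, hb, hb', h⟩, rfl, rfl⟩

end Tri

instance : S.proj.Additive where
  map_add := rfl

lemma proj_map_eq_iff {X Y : S.Tri} (φ ψ : X ⟶ Y) :
    S.proj.map φ = S.proj.map ψ ↔ Tri.MemR₂ (φ - ψ) := by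
  rw [← proj_map_eq_zero_iff, Functor.map_sub, sub_eq_zero]

lemma proj_map_eq_of_φ₃ {X Y : S.Tri} {φ ψ : X ⟶ Y} (h : φ.φ₃ = ψ.φ₃) :
    S.proj.map φ = S.proj.map ψ :=
  (proj_map_eq_iff φ ψ).2 ⟨0, by simp [h]⟩

lemma proj_map_eq_of_φ₁ {X Y : S.Tri} {φ ψ : X ⟶ Y} (h : φ.φ₁ = ψ.φ₁) :
    S.proj.map φ = S.proj.map ψ :=
  (proj_map_eq_iff φ ψ).2 ((Tri.memR₂_iff_exists _).2 ⟨0, by simp [sub_eq_add_neg, h]⟩)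

/-- Membership in `𝓡₂` can be tested on first components, where `φ` is cancellable. -/
lemma mono_proj_map {X Y : S.Tri} (φ : X ⟶ Y) [IsIso φ.φ₁] : Mono (S.proj.map φ) := by
  apply Preadditive.mono_of_cancel_zero
  rintro W g hg
  obtain ⟨χ, rfl⟩ := S.proj.map_surjective (X := W.as) g
  rw [← Functor.map_comp, proj_map_eq_zero_iff, Tri.memR₂_iff_exists] at hg
  obtain ⟨p, hp⟩ := hg
  exact (proj_map_eq_zero_iff S χ).2 ((Tri.memR₂_iff_exists χ).2
    ⟨p ≫ inv φ.φ₁, by rw [← Category.assoc, hp]; simp⟩)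

lemma epi_proj_map {X Y : S.Tri} (φ : X ⟶ Y) [IsIso φ.φ₃] : Epi (S.proj.map φ) := by
  apply Preadditive.epi_of_cancel_zero
  rintro W g hg
  obtain ⟨χ, rfl⟩ := S.proj.map_surjective (Y := W.as) g
  rw [← Functor.map_comp, proj_map_eq_zero_iff] at hg
  obtain ⟨p, hp⟩ := hg
  exact (proj_map_eq_zero_iff S χ).2 ⟨inv φ.φ₃ ≫ p, by simp [hp]⟩

/-- Uniqueness of lifts is automatic from `mono_proj_map`, so existence on representatives suffices.
-/
lemma exists_isKernel_proj {X Y W : S.Tri} (φ : X ⟶ Y) (k : W ⟶ X) [IsIso k.φ₁]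
    (h : Tri.MemR₂ (k ≫ φ))
    (lift : ∀ {T : S.Tri} (ψ : T ⟶ X), Tri.MemR₂ (ψ ≫ φ) →
      ∃ l : T ⟶ W, S.proj.map (l ≫ k) = S.proj.map ψ) :
    ∃ hk : S.proj.map k ≫ S.proj.map φ = 0,
      Nonempty (IsLimit (KernelFork.ofι (S.proj.map k) hk)) := by
  have := mono_proj_map k
  refine ⟨by rwa [← Functor.map_comp, proj_map_eq_zero_iff], ⟨KernelFork.IsLimit.ofι' _ _ ?_⟩⟩
  intro T g hg
  have : ∃ l, l ≫ S.proj.map k = g := by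
    obtain ⟨ψ, rfl⟩ := S.proj.map_surjective (X := T.as) g
    rw [← Functor.map_comp, proj_map_eq_zero_iff] at hg
    obtain ⟨l, hl⟩ := lift ψ hg
    exact ⟨S.proj.map l, by rw [← Functor.map_comp, hl]⟩
  exact ⟨this.choose, this.choose_spec⟩

lemma exists_isCokernel_proj {X Y W : S.Tri} (φ : X ⟶ Y) (c : Y ⟶ W) [IsIso c.φ₃]
    (h : Tri.MemR₂ (φ ≫ c))
    (desc : ∀ {T : S.Tri} (ψ : Y ⟶ T), Tri.MemR₂ (φ ≫ ψ) →
      ∃ l : W ⟶ T, S.proj.map (c ≫ l) = S.proj.map ψ) :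
    ∃ hc : S.proj.map φ ≫ S.proj.map c = 0,
      Nonempty (IsColimit (CokernelCofork.ofπ (S.proj.map c) hc)) := by
  have := epi_proj_map c
  refine ⟨by rwa [← Functor.map_comp, proj_map_eq_zero_iff], ⟨CokernelCofork.IsColimit.ofπ' _ _ ?_⟩⟩
  intro T g hg
  have : ∃ l, S.proj.map c ≫ l = g := by
    obtain ⟨ψ, rfl⟩ := S.proj.map_surjective (Y := T.as) g
    rw [← Functor.map_comp, proj_map_eq_zero_iff] at hg
    obtain ⟨l, hl⟩ := desc ψ hg
    exact ⟨S.proj.map l, by rw [← Functor.map_comp, hl]⟩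
  exact ⟨this.choose, this.choose_spec⟩

/-! ### Universal properties of `k`, `c`, `π` and `i`. -/

namespace FactorData

variable {X Y : S.Tri} {φ : X ⟶ Y} {Z : C} {h₁ : Y.X₁ ⟶ Z} {h₂ : Z ⟶ X.X₃}
  (D : FactorData φ h₁ h₂)

instance : IsIso D.k.φ₁ := inferInstanceAs (IsIso (𝟙 X.X₁))

instance : IsIso D.i.φ₁ := inferInstanceAs (IsIso (𝟙 Y.X₁))

instance : IsIso D.π.φ₃ := inferInstanceAs (IsIso (𝟙 X.X₃))

instance : IsIso D.c.φ₃ := inferInstanceAs (IsIso (𝟙 Y.X₃))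

lemma proj_fac : S.proj.map φ = S.proj.map D.π ≫ S.proj.map D.i := by
  rw [← Functor.map_comp]
  exact proj_map_eq_of_φ₃ (Category.id_comp φ.φ₃).symm

lemma isKernel_k : ∃ hk : S.proj.map D.k ≫ S.proj.map φ = 0,
    Nonempty (IsLimit (KernelFork.ofι (S.proj.map D.k) hk)) := by
  refine exists_isKernel_proj φ D.k ⟨D.a₂, D.a₂_f₂⟩ ?_
  rintro T ψ ⟨p, hp⟩
  -- The factorization `p` of `ψ₃ ≫ φ₃` says exactly that `(ψ₃, p)` is killed by the deflation of
  -- `C(φ)`; hence it lifts to `Z`, the third term of `K(φ)`.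
  obtain ⟨q, hq⟩ := D.triC.exists_lift_inf (biprod.lift ψ.φ₃ p) (by
    simp [biprod.lift_desc, hp])
  have hq₂ : q ≫ h₂ = ψ.φ₃ := by simpa using congrArg (· ≫ biprod.fst) hq
  obtain ⟨l, -, hl⟩ := Tri.exists_hom (X := T) (Y := D.K) ψ.φ₁ q (by
    refine Eq.trans ψ.ext_comm ?_
    rw [← hq₂, pull_comp]
    rfl)
  refine ⟨l, proj_map_eq_of_φ₃ ?_⟩
  rw [Tri.comp_φ₃, hl]
  exact hq₂

lemma isCokernel_c : ∃ hc : S.proj.map φ ≫ S.proj.map D.c = 0,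
    Nonempty (IsColimit (CokernelCofork.ofπ (S.proj.map D.c) hc)) := by
  refine exists_isCokernel_proj φ D.c ((Tri.memR₂_iff_exists _).2 ⟨D.a₁, D.f₁_a₁⟩) ?_
  intro T ψ hψ
  obtain ⟨p, hp⟩ := (Tri.memR₂_iff_exists _).1 hψ
  obtain ⟨q, hq⟩ := D.triK.exists_desc_defl (biprod.desc p (-ψ.φ₁)) (by
    simp [biprod.lift_desc, hp])
  have hq₁ : h₁ ≫ q = ψ.φ₁ := by simpa using congrArg (biprod.inr ≫ ·) hq
  obtain ⟨l, hl, -⟩ := Tri.exists_hom (X := D.Q) (Y := T) q ψ.φ₃ (by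
    refine Eq.trans ?_ ψ.ext_comm
    rw [← hq₁, push_comp]
    rfl)
  refine ⟨l, proj_map_eq_of_φ₁ ?_⟩
  rw [Tri.comp_φ₁, hl]
  exact hq₁

lemma isCokernel_π : ∃ hπ : S.proj.map D.k ≫ S.proj.map D.π = 0,
    Nonempty (IsColimit (CokernelCofork.ofπ (S.proj.map D.π) hπ)) := by
  refine exists_isCokernel_proj D.k D.π ⟨𝟙 Z, (Category.id_comp h₂).trans
    (Category.comp_id h₂).symm⟩ ?_
  intro T ψ hψ
  obtain ⟨p, hp⟩ := (Tri.memR₂_iff_exists _).1 hψ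
  change X.X₂ ⊞ Y.X₁ ⟶ T.X₁ at p
  replace hp : biprod.lift X.f₁ φ.φ₁ ≫ p = ψ.φ₁ := hp.trans (Category.id_comp _)
  -- The first summand annihilates `δ`, so pushing `δ` along `ψ₁` factors through `φ₁_* δ`, the
  -- extension of `I(φ)`.
  have hp' : ψ.φ₁ = X.f₁ ≫ biprod.inl ≫ p + φ.φ₁ ≫ biprod.inr ≫ p := by
    rw [← hp, biprod.lift_eq]; simp
  obtain ⟨l, -, hl⟩ := Tri.exists_hom (X := D.I) (Y := T) (biprod.inr ≫ p) ψ.φ₃ (by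
    refine Eq.trans ?_ ψ.ext_comm
    rw [hp', push_add, push_comp X.f₁, X.isTriangle.push_inf, push_map_zero, zero_add,
      push_comp φ.φ₁]
    rfl)
  refine ⟨l, proj_map_eq_of_φ₃ ?_⟩
  rw [Tri.comp_φ₃, hl]
  exact Category.id_comp _

lemma isKernel_i : ∃ hi : S.proj.map D.i ≫ S.proj.map D.c = 0,
    Nonempty (IsLimit (KernelFork.ofι (S.proj.map D.i) hi)) := by
  refine exists_isKernel_proj D.c D.i ((Tri.memR₂_iff_exists _).2
    ⟨𝟙 Z, (Category.comp_id h₁).trans (Category.id_comp h₁).symm⟩) ?_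
  rintro T ψ ⟨p, hp⟩
  change T.X₃ ⟶ X.X₃ ⊞ Y.X₂ at p
  replace hp : p ≫ biprod.desc (-φ.φ₃) Y.f₂ = ψ.φ₃ := hp.trans (Category.comp_id _)
  -- The sign compensates the `-φ₃` in `C(φ)`; the second summand annihilates `δ'`.
  have hp' : ψ.φ₃ = (-(p ≫ biprod.fst)) ≫ φ.φ₃ + (p ≫ biprod.snd) ≫ Y.f₂ := by
    rw [← hp, biprod.desc_eq]; simp
  obtain ⟨l, hl, -⟩ := Tri.exists_hom (X := T) (Y := D.I) ψ.φ₁ (-(p ≫ biprod.fst)) (by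
    refine Eq.trans ψ.ext_comm ?_
    rw [hp', pull_add, pull_comp _ Y.f₂, Y.isTriangle.pull_defl, pull_map_zero, add_zero,
      pull_comp, ← show push φ.φ₁ X.δ = pull φ.φ₃ Y.δ from φ.ext_comm]
    rfl)
  refine ⟨l, proj_map_eq_of_φ₁ ?_⟩
  rw [Tri.comp_φ₁, hl]
  exact Category.comp_id _

end FactorData

lemma exists_factorData {X Y : S.Tri} (φ : X ⟶ Y) :
    ∃ (Z : C) (h₁ : Y.X₁ ⟶ Z) (h₂ : Z ⟶ X.X₃), Nonempty (FactorData φ h₁ h₂) := by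
  obtain ⟨Z, h₁, h₂, h⟩ := exists_isTriangle (push φ.φ₁ X.δ)
  exact ⟨Z, h₁, h₂, nonempty_factorData φ h₁ h₂ h⟩

/-! ### Additivity and abelianness of the quotient. -/

/-- The direct sum of two `𝔰`-triangles. -/
noncomputable def Tri.sum (X Y : S.Tri) : S.Tri where
  X₁ := X.X₁ ⊞ Y.X₁
  X₂ := X.X₂ ⊞ Y.X₂
  X₃ := X.X₃ ⊞ Y.X₃
  f₁ := biprod.map X.f₁ Y.f₁
  f₂ := biprod.map X.f₂ Y.f₂
  δ := extSum X.δ Y.δ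
  isTriangle := S.s_sum X.isTriangle Y.isTriangle

/-- The direct sum of two `𝔰`-triangles is a biproduct. -/
noncomputable def Tri.bicone (X Y : S.Tri) : BinaryBicone X Y where
  pt := X.sum Y
  fst :=
    { φ₁ := (biprod.fst : X.X₁ ⊞ Y.X₁ ⟶ X.X₁)
      φ₂ := (biprod.fst : X.X₂ ⊞ Y.X₂ ⟶ X.X₂)
      φ₃ := (biprod.fst : X.X₃ ⊞ Y.X₃ ⟶ X.X₃)
      comm₁ := by simp [Tri.sum]
      comm₂ := by simp [Tri.sum]
      ext_comm := by
        simp [Tri.sum, IsExtHom, extSum, push_map_add, ← push_comp, push_zero, push_id] }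
  snd :=
    { φ₁ := (biprod.snd : X.X₁ ⊞ Y.X₁ ⟶ Y.X₁)
      φ₂ := (biprod.snd : X.X₂ ⊞ Y.X₂ ⟶ Y.X₂)
      φ₃ := (biprod.snd : X.X₃ ⊞ Y.X₃ ⟶ Y.X₃)
      comm₁ := by simp [Tri.sum]
      comm₂ := by simp [Tri.sum]
      ext_comm := by
        simp [Tri.sum, IsExtHom, extSum, push_map_add, ← push_comp, push_zero, push_id] }
  inl :=
    { φ₁ := (biprod.inl : X.X₁ ⟶ X.X₁ ⊞ Y.X₁)
      φ₂ := (biprod.inl : X.X₂ ⟶ X.X₂ ⊞ Y.X₂)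
      φ₃ := (biprod.inl : X.X₃ ⟶ X.X₃ ⊞ Y.X₃)
      comm₁ := by simp [Tri.sum]
      comm₂ := by simp [Tri.sum]
      ext_comm := by
        simp [Tri.sum, IsExtHom, extSum, pull_map_add, push_pull, ← pull_comp, pull_zero, pull_id] }
  inr :=
    { φ₁ := (biprod.inr : Y.X₁ ⟶ X.X₁ ⊞ Y.X₁)
      φ₂ := (biprod.inr : Y.X₂ ⟶ X.X₂ ⊞ Y.X₂)
      φ₃ := (biprod.inr : Y.X₃ ⟶ X.X₃ ⊞ Y.X₃)
      comm₁ := by simp [Tri.sum]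
      comm₂ := by simp [Tri.sum]
      ext_comm := by
        simp [Tri.sum, IsExtHom, extSum, pull_map_add, push_pull, ← pull_comp, pull_zero, pull_id] }
  inl_fst := by ext <;> exact biprod.inl_fst
  inl_snd := by ext <;> exact biprod.inl_snd
  inr_fst := by ext <;> exact biprod.inr_fst
  inr_snd := by ext <;> exact biprod.inr_snd

lemma Tri.bicone_total (X Y : S.Tri) :
    (X.bicone Y).fst ≫ (X.bicone Y).inl + (X.bicone Y).snd ≫ (X.bicone Y).inr =
      𝟙 (X.bicone Y).pt := by
  ext <;> exact biprod.total

/-- The split `𝔰`-triangle with zero ends. -/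
noncomputable def Tri.zero (S : ExtriangulatedStructure.{w} C) : S.Tri where
  X₁ := 0
  X₂ := 0 ⊞ 0
  X₃ := 0
  f₁ := biprod.inl
  f₂ := biprod.snd
  δ := 0
  isTriangle := S.s_zero 0 0

instance : HasZeroObject S.TriQuot where
  zero := ⟨S.proj.obj (Tri.zero S), by
    rw [IsZero.iff_id_eq_zero, ← S.proj.map_id, proj_map_eq_zero_iff]
    exact ⟨0, (isZero_zero C).eq_of_src _ _⟩⟩

instance : HasBinaryBiproducts S.TriQuot where
  has_binary_biproduct X Y :=
    hasBinaryBiproduct_of_total (S.proj.mapBinaryBicone (X.as.bicone Y.as))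
      (congrArg S.proj.map (X.as.bicone_total Y.as))

instance : HasFiniteProducts S.TriQuot := hasFiniteProducts_of_has_binary_and_terminal

instance : HasKernels S.TriQuot where
  has_limit {X Y} f := by
    obtain ⟨φ, rfl⟩ := S.proj.map_surjective (X := X.as) (Y := Y.as) f
    obtain ⟨Z, h₁, h₂, ⟨D⟩⟩ := exists_factorData φ
    obtain ⟨_, ⟨h⟩⟩ := D.isKernel_k
    exact ⟨⟨_, h⟩⟩

instance : HasCokernels S.TriQuot where
  has_colimit {X Y} f := by
    obtain ⟨φ, rfl⟩ := S.proj.map_surjective (X := X.as) (Y := Y.as) f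
    obtain ⟨Z, h₁, h₂, ⟨D⟩⟩ := exists_factorData φ
    obtain ⟨_, ⟨h⟩⟩ := D.isCokernel_c
    exact ⟨⟨_, h⟩⟩

instance : IsNormalMonoCategory S.TriQuot where
  normalMonoOfMono {X Y} f hf := by
    obtain ⟨φ, rfl⟩ := S.proj.map_surjective (X := X.as) (Y := Y.as) f
    obtain ⟨Z, h₁, h₂, ⟨D⟩⟩ := exists_factorData φ
    obtain ⟨hk, -⟩ := D.isKernel_k
    obtain ⟨_, ⟨hπ⟩⟩ := D.isCokernel_π
    obtain ⟨_, ⟨hi⟩⟩ := D.isKernel_i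
    -- A mono has `k̲ = 0`, and a cokernel of zero is invertible.
    have : IsIso (S.proj.map D.π) :=
      CokernelCofork.IsColimit.isIso_π _ hπ (zero_of_comp_mono _ hk)
    exact ⟨⟨_, S.proj.map D.c, _,
      IsKernel.isoKernel _ _ hi (asIso (S.proj.map D.π)) D.proj_fac.symm⟩⟩

instance : IsNormalEpiCategory S.TriQuot where
  normalEpiOfEpi {X Y} f hf := by
    obtain ⟨φ, rfl⟩ := S.proj.map_surjective (X := X.as) (Y := Y.as) f
    obtain ⟨Z, h₁, h₂, ⟨D⟩⟩ := exists_factorData φ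
    obtain ⟨hc, -⟩ := D.isCokernel_c
    obtain ⟨_, ⟨hπ⟩⟩ := D.isCokernel_π
    obtain ⟨_, ⟨hi⟩⟩ := D.isKernel_i
    have : IsIso (S.proj.map D.i) :=
      KernelFork.IsLimit.isIso_ι _ hi (zero_of_epi_comp _ hc)
    exact ⟨⟨_, S.proj.map D.k, _,
      IsCokernel.cokernelIso _ _ hπ (asIso (S.proj.map D.i)) D.proj_fac.symm⟩⟩

/-- The ideal quotient `𝔰-tri(C)/𝓡₂` is an abelian category. -/
@[reducible]
noncomputable def abelianTriQuot (S : ExtriangulatedStructure.{w} C) : Abelian S.TriQuot where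

end ExtriangulatedStructure

end Extriangulated

theorem mainTheorem3 {C : Type u} [Category.{v} C] [Preadditive C] [HasZeroObject C]
    [HasBinaryBiproducts C] (S : Extriangulated.ExtriangulatedStructure.{w} C) :
    (∃ ab : Abelian S.TriQuot, ab.toPreadditive = S.preadditiveTriQuot) ∧
    ∀ {X Y : S.Tri} (φ : X ⟶ Y),
      (∃ (Z : C) (h₁ : Y.X₁ ⟶ Z) (h₂ : Z ⟶ X.X₃), S.IsTriangle h₁ h₂ (Extriangulated.push φ.φ₁ X.δ)) ∧
      ∀ {Z : C} (h₁ : Y.X₁ ⟶ Z) (h₂ : Z ⟶ X.X₃), S.IsTriangle h₁ h₂ (Extriangulated.push φ.φ₁ X.δ) →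
        Nonempty (Extriangulated.ExtriangulatedStructure.FactorData φ h₁ h₂) ∧
        ∀ D : Extriangulated.ExtriangulatedStructure.FactorData φ h₁ h₂,
          S.proj.map φ = S.proj.map D.π ≫ S.proj.map D.i ∧
          (∃ hk : S.proj.map D.k ≫ S.proj.map φ = 0,
            Nonempty (IsLimit (KernelFork.ofι (S.proj.map D.k) hk))) ∧
          (∃ hc : S.proj.map φ ≫ S.proj.map D.c = 0,
            Nonempty (IsColimit (CokernelCofork.ofπ (S.proj.map D.c) hc))) ∧
          (∃ hπ : S.proj.map D.k ≫ S.proj.map D.π = 0,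
            Nonempty (IsColimit (CokernelCofork.ofπ (S.proj.map D.π) hπ))) ∧
          (∃ hi : S.proj.map D.i ≫ S.proj.map D.c = 0,
            Nonempty (IsLimit (KernelFork.ofι (S.proj.map D.i) hi))) := by
  refine ⟨⟨S.abelianTriQuot, rfl⟩, fun φ =>
    ⟨Extriangulated.ExtriangulatedStructure.exists_isTriangle _, fun h₁ h₂ h =>
      ⟨Extriangulated.ExtriangulatedStructure.nonempty_factorData φ h₁ h₂ h, fun D =>
        ⟨D.proj_fac, D.isKernel_k, D.isCokernel_c, D.isCokernel_π, D.isKernel_i⟩⟩⟩⟩
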